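/- All graphs are finite, simple and undirected. A graph is $K_{1,k}$-free if it has no induced subgraph isomorphic to $K_{1,k}$. The closed neighborhood of a vertex $v$ is $N_G[v]=\{v\}\cup N_G(v)$. For a positive integer $r$, a graph $G$ is $r$-CFCN$^*$-choosable if for every assignment of lists $L_v$ of colors with $|L_v|=r$ to the vertices $v\in V(G)$ there are a subset $V'\subseteq V(G)$ and a coloring $f$ of $V'$ with $f(v)\in L_v$ for all $v\in V'$ such that for every $v\in V(G)$ some color is assigned by $f$ to exactly one vertex of $N_G[v]\cap V'$. The CFCN$^*$ choice number $ch^*_{CN}(G)$ is the least positive integer $r$ such that $G$ is $r$-CFCN$^*$-choosable. **Theorem.** There is an absolute constant $C>0$ such that for every non-negative integer $k$ and every $K_{1,k}$-free graph $G$ with maximum degree $\Delta\ge 2$, $$ch^*_{CN}(G)\le C\,k\ln\Delta .$$ Moreover, if $k\le \frac{\ln\Delta}{8}$, then $G$ is $r$-CFCN$^*$-choosable for every integer $r\ge 2^{18}k\ln\Delta$. -/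

import Mathlib

universe u

namespace SimpleGraph

/-- The closed neighbourhood `N[v] = {v} ∪ N(v)`. -/
def closedNbhd {V : Type*} (G : SimpleGraph V) (v : V) : Set V :=
  insert v (G.neighborSet v)

/-- `G` is `K_{1,k}`-free: it has no induced subgraph isomorphic to `K_{1,k}`. -/
def IsStarFree {V : Type*} (G : SimpleGraph V) (k : ℕ) : Prop :=
  ¬ (completeBipartiteGraph (Fin 1) (Fin k)).IsIndContained G

/-- `f` is a partial colouring (`f v = none` means that `v` is not coloured) in which every
vertex `v` sees some colour exactly once in its closed neighbourhood. -/
def IsCFCNColoring {V α : Type*} (G : SimpleGraph V) (f : V → Option α) : Prop :=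
  ∀ v : V, ∃ c : α, ∃! u : V, u ∈ G.closedNbhd v ∧ f u = some c

/-- For the list assignment `L` there is a conflict-free closed-neighbourhood colouring of a
subset of the vertices in which every coloured vertex gets a colour from its list. -/
def IsListCFCNColorable {V α : Type*} (G : SimpleGraph V) (L : V → Finset α) : Prop :=
  ∃ f : V → Option α, (∀ v : V, ∀ c : α, f v = some c → c ∈ L v) ∧ G.IsCFCNColoring f

/-- `G` is `r`-CFCN*-choosable: it is list colourable for every assignment of lists with exactly
`r` colours. Colours are natural numbers; see `IsCFCNChoosable.isListCFCNColorable` for colours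
of any other kind. -/
def IsCFCNChoosable {V : Type*} (G : SimpleGraph V) (r : ℕ) : Prop :=
  ∀ L : V → Finset ℕ, (∀ v : V, (L v).card = r) → G.IsListCFCNColorable L

/-- The CFCN* choice number: the least positive `r` such that `G` is `r`-CFCN*-choosable.
For a finite graph such an `r` exists, see `exists_isCFCNChoosable`. -/
noncomputable def cfcnChoiceNumber {V : Type*} (G : SimpleGraph V) : ℕ :=
  sInf {r : ℕ | 0 < r ∧ G.IsCFCNChoosable r}

theorem exists_isCFCNChoosable {V : Type*} [Finite V] (G : SimpleGraph V) :
    ∃ r : ℕ, 0 < r ∧ G.IsCFCNChoosable r := by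
  classical
  have := Fintype.ofFinite V
  refine ⟨Fintype.card V + 1, Nat.succ_pos _, fun L hL => ?_⟩
  obtain ⟨f, hinj, hf⟩ :=
    (Finset.all_card_le_biUnion_card_iff_exists_injective L).1 (fun s => by
      rcases s.eq_empty_or_nonempty with rfl | ⟨v, hv⟩
      · simp
      · calc s.card ≤ Fintype.card V := Finset.card_le_univ s
          _ ≤ (L v).card := by rw [hL]; exact Nat.le_succ _
          _ ≤ (s.biUnion L).card :=
            Finset.card_le_card (Finset.subset_biUnion_of_mem L hv))
  refine ⟨fun v => some (f v), fun v c h => ?_, fun v => ⟨f v, v, ?_, ?_⟩⟩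
  · cases h
    exact hf v
  · exact ⟨Set.mem_insert _ _, rfl⟩
  · rintro w ⟨-, hw⟩
    exact hinj (Option.some.inj hw)

/-- The choice number is attained, so the infimum defining it is a genuine minimum. -/
theorem isLeast_cfcnChoiceNumber {V : Type*} [Finite V] (G : SimpleGraph V) :
    IsLeast {r : ℕ | 0 < r ∧ G.IsCFCNChoosable r} G.cfcnChoiceNumber :=
  ⟨Nat.sInf_mem G.exists_isCFCNChoosable, fun _ h => Nat.sInf_le h⟩

/-- On a finite graph, restricting the colours to natural numbers loses nothing. -/
theorem IsCFCNChoosable.isListCFCNColorable {V α : Type*} [Finite V] {G : SimpleGraph V} {r : ℕ}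
    (h : G.IsCFCNChoosable r) (L : V → Finset α) (hL : ∀ v : V, (L v).card = r) :
    G.IsListCFCNColorable L := by
  classical
  have := Fintype.ofFinite V
  obtain ⟨e, he⟩ : ∃ e : α → ℕ, Set.InjOn e (Finset.univ.biUnion L : Finset α) :=
    Set.countable_iff_exists_injOn.1 (Finset.countable_toSet _)
  have hmem : ∀ v : V, ∀ a ∈ L v, a ∈ ((Finset.univ.biUnion L : Finset α) : Set α) :=
    fun v a ha => by simpa using ⟨v, ha⟩
  obtain ⟨f, hfL, hf⟩ := h (fun v => (L v).image e) (fun v => by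
    rw [Finset.card_image_of_injOn (he.mono (hmem v)), hL])
  have key : ∀ v : V, ∃ o : Option α, (∀ a, o = some a → a ∈ L v) ∧ o.map e = f v := by
    intro v
    cases hv : f v with
    | none => exact ⟨none, by simp, rfl⟩
    | some c =>
      obtain ⟨a, ha, hac⟩ := Finset.mem_image.1 (hfL v c hv)
      exact ⟨some a, by rintro b ⟨⟩; exact ha, by simp [hac]⟩
  choose g hgL hg using key
  refine ⟨g, hgL, fun v => ?_⟩
  obtain ⟨c, u, ⟨hu, huc⟩, huniq⟩ := hf v
  rw [← hg u] at huc
  obtain ⟨a, hga, hac⟩ := Option.map_eq_some_iff.1 huc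
  refine ⟨a, u, ⟨hu, hga⟩, fun w hw => huniq w ⟨hw.1, ?_⟩⟩
  rw [← hg w, hw.2, Option.map_some, hac]

end SimpleGraph

/-!
Let `Δ` be the maximum degree and `t = ⌈log Δ⌉`. Choose a set `B` of vertices that is maximal
among those inducing a `t`-colourable subgraph (`IsStarFree.exists_skeleton`). A vertex outside
`B` has a neighbour in each of the `t` colour classes, and, as the classes are independent and the
graph is `K_{1,k}`-free, every vertex has at most `t * k` neighbours in `B`. Only `B` is coloured.
It suffices to find a list colouring of `B` that is proper on the induced subgraph, so that each
vertex of `B` is the only one in its closed neighbourhood with its colour, and that has a unique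
colour on `e = N(v) ∩ B` for each `v ∉ B`, where `t ≤ #e ≤ t * k`.

Such colourings exist for lists of size `r ≥ 2 ^ 16 * t * k` by a counting argument in the style
of Rosenfeld, which replaces the Lovász Local Lemma: adding one vertex to `S ⊆ B` multiplies the
number of good colourings of `S` by at least `r / 2` (`mul_card_goodColorings_le`). At most `t * k
≤ r / 4` colours are lost to properness. On an edge of size `m`, at most a fraction `2 ^ (-7 * m)`
of the colourings have no unique colour (`card_filter_not_hasUniqueColor`), since these use at
most `m / 2` colours. This fraction refers to all `r ^ m` colourings of the edge, whereas the
induction only gives a factor `r / 2` per vertex; but `2 ^ (-7 * m)` absorbs both this loss of `2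
^ m` and the number of edges at a vertex, which is at most `Δ ≤ 4 ^ t ≤ 4 ^ m`. So the edges cost
at most `r / 4` extensions per colouring in total.

Since `t ≤ 4 * log Δ`, lists of size `2 ^ 18 * k * log Δ` are large enough for every `k`
(`IsStarFree.isCFCNChoosable_of_log_le`), and both parts of the theorem follow from this.
-/

namespace SimpleGraph

/-! ### Counting good list colourings -/

section Counting

open scoped Classical

variable {V : Type*}

/-- Some colour is assigned by `f` to exactly one element of `e`. -/
def HasUniqueColor (f : V → ℕ) (e : Finset V) : Prop :=
  ∃ u ∈ e, ∀ w ∈ e, f w = f u → w = u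

lemma HasUniqueColor.congr {f g : V → ℕ} {e : Finset V} (h : ∀ u ∈ e, f u = g u)
    (hf : HasUniqueColor f e) : HasUniqueColor g e := by
  obtain ⟨u, hu, huniq⟩ := hf
  exact ⟨u, hu, fun w hw hwu => huniq w hw (by rw [h w hw, h u hu, hwu])⟩

variable [Fintype V]

/-- Colourings of the vertices of `S` from the lists `L`, encoded as total functions that take
the value `0` outside `S`, so that they form a finite set. -/
noncomputable def listColorings (L : V → Finset ℕ) (S : Finset V) : Finset (V → ℕ) :=
  Fintype.piFinset fun v => if v ∈ S then L v else {0}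

/-- List colourings of `S` that are proper on the graph induced by `S` and have a unique colour on
each edge of the hypergraph `E` that lies inside `S`. Edges that are only partly contained in `S`
impose nothing, so this property passes to subsets of `S`. -/
noncomputable def goodColorings (G : SimpleGraph V) (E : Finset (Finset V)) (L : V → Finset ℕ)
    (S : Finset V) : Finset (V → ℕ) :=
  (listColorings L S).filter fun f =>
    (∀ u ∈ S, ∀ w ∈ S, G.Adj u w → f u ≠ f w) ∧ ∀ e ∈ E, e ⊆ S → HasUniqueColor f e

lemma mem_listColorings {L : V → Finset ℕ} {S : Finset V} {f : V → ℕ} :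
    f ∈ listColorings L S ↔ (∀ v ∈ S, f v ∈ L v) ∧ ∀ v ∉ S, f v = 0 := by
  simp only [listColorings, Fintype.mem_piFinset]
  refine ⟨fun h => ⟨fun v hv => by simpa [hv] using h v, fun v hv => by simpa [hv] using h v⟩,
    fun h v => ?_⟩
  by_cases hv : v ∈ S
  · simpa [hv] using h.1 v hv
  · simpa [hv] using h.2 v hv

lemma card_listColorings {L : V → Finset ℕ} {r : ℕ} (hL : ∀ v, (L v).card = r) (S : Finset V) :
    (listColorings L S).card = r ^ S.card := by
  rw [listColorings, Fintype.card_piFinset]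
  have : ∀ v, (if v ∈ S then L v else ({0} : Finset ℕ)).card = if v ∈ S then r else 1 := by
    intro v
    split_ifs <;> simp [hL]
  simp [this]

/-- A colouring of `e` without a unique colour is determined by its values on a set `F` of at most
half of the elements of `e`, together with a map assigning to each element of `e \ F` an element of
`F` of the same colour. Counting these data shows that such colourings are rare. -/
lemma card_filter_not_hasUniqueColor {L : V → Finset ℕ} {r : ℕ} (hL : ∀ v, (L v).card = r)
    (e : Finset V) (hr : 2 ^ 16 * e.card ≤ r) :
    2 ^ (7 * e.card) * ((listColorings L e).filter fun f => ¬ HasUniqueColor f e).card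
      ≤ r ^ e.card := by
  let P : Finset (Finset V) := e.powerset.filter fun F => 2 * F.card ≤ e.card
  let D : Finset V → Finset (V → ℕ) := fun F =>
    (listColorings L e).filter fun f => ∀ u ∈ e, ∃ w ∈ F, f w = f u
  have hsub : ((listColorings L e).filter fun f => ¬ HasUniqueColor f e) ⊆ P.biUnion D := by
    intro f hf
    rw [Finset.mem_filter] at hf
    -- `F` contains one vertex of each colour; every colour occurs at least twice.
    obtain ⟨F, hFe, hF⟩ := Set.exists_subset_bijOn (e : Set V) f
    have hfin : F.Finite := e.finite_toSet.subset hFe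
    lift F to Finset V using hfin
    have hFe' : F ⊆ e := by exact_mod_cast hFe
    have himg : e.image f = F.image f := by
      apply Finset.coe_injective
      rw [Finset.coe_image, Finset.coe_image, hF.image_eq]
    have hcard : F.card = (e.image f).card := by
      rw [himg, Finset.card_image_of_injOn hF.injOn]
    rw [Finset.mem_biUnion]
    refine ⟨F, ?_, ?_⟩
    · rw [Finset.mem_filter, Finset.mem_powerset]
      refine ⟨hFe', ?_⟩
      rw [hcard]
      apply Finset.mul_card_image_le_card
      intro b hb
      obtain ⟨u, hu, rfl⟩ := Finset.mem_image.1 hb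
      by_contra hlt
      refine hf.2 ⟨u, hu, fun w hw hwu => ?_⟩
      have h1 : ({a ∈ e | f a = f u}).card ≤ 1 := by omega
      exact Finset.card_le_one.1 h1 w (by simp [hw, hwu]) u (by simp [hu])
    · rw [Finset.mem_filter]
      refine ⟨hf.1, fun u hu => ?_⟩
      have : f u ∈ F.image f := himg ▸ Finset.mem_image_of_mem f hu
      simpa using this
  have hD : ∀ F ∈ P, 2 ^ (8 * e.card) * (D F).card ≤ r ^ e.card := by
    intro F hF
    rw [Finset.mem_filter, Finset.mem_powerset] at hF
    obtain ⟨hFe, hF2⟩ := hF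
    have hDF : (D F).card ≤ r ^ F.card * e.card ^ (e.card - F.card) := by
      let X : Finset (V → V) := Fintype.piFinset fun v => if v ∈ e \ F then e else {v}
      have hX : X.card = e.card ^ (e.card - F.card) := by
        rw [Fintype.card_piFinset]
        have : ∀ v, (if v ∈ e \ F then e else ({v} : Finset V)).card
            = if v ∈ e \ F then e.card else 1 := by
          intro v
          split_ifs <;> simp
        simp only [this, Finset.prod_ite, Finset.prod_const, one_pow, mul_one]
        rw [← Finset.card_sdiff_of_subset hFe]
        congr 2
        ext; simp
      rw [← card_listColorings hL F, ← hX, ← Finset.card_product]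
      let φ : (V → ℕ) × (V → V) → V → ℕ := fun p u => if u ∈ e then p.1 (p.2 u) else 0
      refine (Finset.card_le_card ?_).trans (Finset.card_image_le (f := φ))
      intro f hf
      rw [Finset.mem_filter, mem_listColorings] at hf
      obtain ⟨⟨hf1, hf2⟩, hf3⟩ := hf
      choose! h hhF hh using hf3
      rw [Finset.mem_image]
      refine ⟨(fun u => if u ∈ F then f u else 0, fun u => if u ∈ e \ F then h u else u), ?_, ?_⟩
      · rw [Finset.mem_product, mem_listColorings, Fintype.mem_piFinset]
        refine ⟨⟨fun v hv => by simpa [hv] using hf1 v (hFe hv), fun v hv => by simp [hv]⟩,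
          fun v => ?_⟩
        by_cases hv : v ∈ e \ F
        · simpa only [hv, if_true] using hFe (hhF v (Finset.mem_sdiff.1 hv).1)
        · simp only [hv, if_false, Finset.mem_singleton]
      · funext u
        by_cases hu : u ∈ e
        · by_cases huF : u ∈ F
          · simp [φ, hu, huF]
          · simp [φ, hu, huF, hhF u hu, hh u hu]
        · simp [φ, hu, hf2 u hu]
    have hle : F.card ≤ e.card := by omega
    calc 2 ^ (8 * e.card) * (D F).card
        ≤ 2 ^ (16 * (e.card - F.card)) * (r ^ F.card * e.card ^ (e.card - F.card)) := by
          refine Nat.mul_le_mul (Nat.pow_le_pow_right (by norm_num) (by omega)) hDF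
      _ = r ^ F.card * (2 ^ 16 * e.card) ^ (e.card - F.card) := by
          rw [mul_pow, ← pow_mul]; ring
      _ ≤ r ^ F.card * r ^ (e.card - F.card) := by gcongr
      _ = r ^ e.card := by rw [← pow_add]; congr 1; omega
  have hP : P.card ≤ 2 ^ e.card :=
    (Finset.card_filter_le _ _).trans (Finset.card_powerset e).le
  have hsum : 2 ^ (8 * e.card) * ((listColorings L e).filter fun f => ¬ HasUniqueColor f e).card
      ≤ 2 ^ e.card * r ^ e.card := by
    calc _ ≤ 2 ^ (8 * e.card) * ∑ F ∈ P, (D F).card :=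
          Nat.mul_le_mul_left _ ((Finset.card_le_card hsub).trans Finset.card_biUnion_le)
      _ = ∑ F ∈ P, 2 ^ (8 * e.card) * (D F).card := Finset.mul_sum _ _ _
      _ ≤ ∑ _F ∈ P, r ^ e.card := Finset.sum_le_sum hD
      _ ≤ 2 ^ e.card * r ^ e.card := by
          rw [Finset.sum_const, smul_eq_mul]
          exact Nat.mul_le_mul_right _ hP
  have h8 : 2 ^ (8 * e.card) = 2 ^ e.card * 2 ^ (7 * e.card) := by rw [← pow_add]; congr 1; ring
  rw [h8, mul_assoc] at hsum
  exact Nat.le_of_mul_le_mul_left hsum (by positivity)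

lemma goodColorings_empty (G : SimpleGraph V) {E : Finset (Finset V)} (L : V → Finset ℕ)
    (hE : ∀ e ∈ E, e.Nonempty) : (goodColorings G E L ∅).card = 1 := by
  rw [Finset.card_eq_one]
  refine ⟨fun _ => 0, Finset.eq_singleton_iff_unique_mem.2 ⟨?_, fun f hf => ?_⟩⟩
  · rw [goodColorings, Finset.mem_filter, mem_listColorings]
    refine ⟨by simp, by simp, fun e he hes => ?_⟩
    exact absurd (Finset.subset_empty.1 hes) (hE e he).ne_empty
  · rw [goodColorings, Finset.mem_filter, mem_listColorings] at hf
    funext v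
    exact hf.1.2 v (Finset.notMem_empty v)

/-- Cutting a good colouring down to a subset keeps it good. -/
lemma indicator_mem_goodColorings {G : SimpleGraph V} {E : Finset (Finset V)} {L : V → Finset ℕ}
    {S T : Finset V} (hTS : T ⊆ S) {f g : V → ℕ} (hf : f ∈ goodColorings G E L S)
    (hfg : ∀ v ∈ T, g v = f v) :
    (fun v => if v ∈ T then g v else 0) ∈ goodColorings G E L T := by
  rw [goodColorings, Finset.mem_filter, mem_listColorings] at hf ⊢
  obtain ⟨⟨hf1, -⟩, hf3, hf4⟩ := hf
  refine ⟨⟨fun v hv => ?_, fun v hv => by simp [hv]⟩, fun u hu w hw huw => ?_, fun e he heT => ?_⟩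
  · simpa [hv, hfg v hv] using hf1 v (hTS hv)
  · simpa [hu, hw, hfg u hu, hfg w hw] using hf3 u (hTS hu) w (hTS hw) huw
  · exact (hf4 e he (heT.trans hTS)).congr fun u hu => by simp [heT hu, hfg u (heT hu)]

/-- The key step of the counting argument: every new vertex multiplies the number of good
colourings by at least `r / 2`. The extensions of a good colouring of `S` to `x` that fail are those
in which `x` repeats a colour of a neighbour (at most `r / 4` colours) and those creating an edge
`e ∋ x` without a unique colour. The latter are determined by a good colouring of `S \ e` and a
colouring of `e` without a unique colour. By induction there are at least `(r / 2) ^ (#e - 1)` times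
as many good colourings of `S` as of `S \ e`, so the bad edges are outnumbered as well. -/
lemma mul_card_goodColorings_le {G : SimpleGraph V} {E : Finset (Finset V)} {L : V → Finset ℕ}
    {r t M : ℕ} (hL : ∀ v, (L v).card = r) (hr : 2 ^ 16 * M ≤ r) (ht : ∀ e ∈ E, t ≤ e.card)
    (hM : ∀ e ∈ E, e.card ≤ M) {B : Finset V}
    (hB : ∀ x ∈ B, (B.filter fun u => G.Adj x u).card ≤ M)
    (hE : ∀ x ∈ B, (E.filter fun e => x ∈ e).card ≤ 2 ^ (2 * t)) :
    ∀ S : Finset V, ∀ x ∉ S, insert x S ⊆ B →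
      r * (goodColorings G E L S).card ≤ 2 * (goodColorings G E L (insert x S)).card := by
  intro S
  induction S using Finset.strongInduction with
  | H S ih =>
  intro x hxS hxB
  have hSB : S ⊆ B := (Finset.subset_insert x S).trans hxB
  -- Removing several vertices from `S`, by iterating the induction hypothesis.
  have hrem : ∀ R : Finset V, R ⊆ S →
      r ^ R.card * (goodColorings G E L (S \ R)).card
        ≤ 2 ^ R.card * (goodColorings G E L S).card := by
    intro R
    induction R using Finset.induction_on with
    | empty => simp
    | insert y R hy ihR =>
      intro hR
      have hyS : y ∈ S := hR (Finset.mem_insert_self y R)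
      have hRS : R ⊆ S := (Finset.subset_insert y R).trans hR
      have hins : insert y (S \ insert y R) = S \ R := by
        ext z
        simp only [Finset.mem_insert, Finset.mem_sdiff]
        by_cases hz : z = y
        · subst hz; simp [hyS, hy]
        · simp [hz]
      have hss : S \ insert y R ⊂ S :=
        Finset.sdiff_ssubset hR ⟨y, Finset.mem_insert_self y R⟩
      have h1 := ih _ hss y (by simp) (by rw [hins]; exact Finset.sdiff_subset.trans hSB)
      rw [hins] at h1
      rw [Finset.card_insert_of_notMem hy]
      calc r ^ (R.card + 1) * (goodColorings G E L (S \ insert y R)).card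
          = r ^ R.card * (r * (goodColorings G E L (S \ insert y R)).card) := by ring
        _ ≤ r ^ R.card * (2 * (goodColorings G E L (S \ R)).card) := by gcongr
        _ = 2 * (r ^ R.card * (goodColorings G E L (S \ R)).card) := by ring
        _ ≤ 2 * (2 ^ R.card * (goodColorings G E L S).card) :=
            Nat.mul_le_mul_left _ (ihR hRS)
        _ = _ := by ring
  set C := goodColorings G E L S with hC
  -- `ψ p` extends the good colouring `p.1` of `S` by the colour `p.2` at `x`.
  let X : Finset ((V → ℕ) × ℕ) := C ×ˢ L x
  let ψ : (V → ℕ) × ℕ → V → ℕ := fun p => Function.update p.1 x p.2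
  have hψx : ∀ p, ψ p x = p.2 := fun p => Function.update_self _ _ _
  have hψ : ∀ p, ∀ v, v ≠ x → ψ p v = p.1 v := fun p v hv => Function.update_of_ne hv _ _
  have hψinj : ∀ p ∈ X, ∀ q ∈ X, ψ p = ψ q → p = q := by
    intro p hp q hq hpq
    have hp0 : p.1 x = 0 := by
      have := (Finset.mem_product.1 hp).1
      rw [hC, goodColorings, Finset.mem_filter, mem_listColorings] at this
      exact this.1.2 x hxS
    have hq0 : q.1 x = 0 := by
      have := (Finset.mem_product.1 hq).1
      rw [hC, goodColorings, Finset.mem_filter, mem_listColorings] at this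
      exact this.1.2 x hxS
    refine Prod.ext (funext fun v => ?_) (by rw [← hψx p, hpq, hψx q])
    by_cases hv : v = x
    · rw [hv, hp0, hq0]
    · rw [← hψ p v hv, hpq, hψ q v hv]
  have hψlist : ∀ p ∈ X, ψ p ∈ listColorings L (insert x S) := by
    intro p hp
    obtain ⟨hp1, hp2⟩ := Finset.mem_product.1 hp
    rw [hC, goodColorings, Finset.mem_filter, mem_listColorings] at hp1
    rw [mem_listColorings]
    refine ⟨fun v hv => ?_, fun v hv => ?_⟩
    · by_cases hvx : v = x
      · subst hvx; rw [hψx]; exact hp2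
      · rw [hψ p v hvx]
        exact hp1.1.1 v ((Finset.mem_insert.1 hv).resolve_left hvx)
    · rw [Finset.mem_insert, not_or] at hv
      rw [hψ p v hv.1]
      exact hp1.1.2 v hv.2
  -- `X₀`: good extensions; `X₁`: `x` repeats the colour of a neighbour; `X₂ e`: the edge `e`
  -- is left without a unique colour.
  let X₀ := X.filter fun p => ψ p ∈ goodColorings G E L (insert x S)
  let X₁ := X.filter fun p => ∃ u ∈ S, G.Adj x u ∧ p.1 u = p.2
  let Ex := E.filter fun e => x ∈ e
  let X₂ : Finset V → Finset ((V → ℕ) × ℕ) := fun e =>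
    X.filter fun p => e ⊆ insert x S ∧ ¬ HasUniqueColor (ψ p) e
  have hcover : X ⊆ X₀ ∪ (X₁ ∪ Ex.biUnion X₂) := by
    intro p hp
    by_contra hnot
    simp only [Finset.mem_union, not_or, Finset.mem_biUnion, not_exists, not_and] at hnot
    obtain ⟨h0, h1, h2⟩ := hnot
    have h1' : ∀ u ∈ S, G.Adj x u → p.1 u ≠ p.2 := fun u hu hxu heq =>
      h1 (Finset.mem_filter.2 ⟨hp, u, hu, hxu, heq⟩)
    have hp1 := (Finset.mem_product.1 hp).1
    rw [hC, goodColorings, Finset.mem_filter] at hp1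
    obtain ⟨-, hprop, hedge⟩ := hp1
    refine h0 (Finset.mem_filter.2 ⟨hp, ?_⟩)
    rw [goodColorings, Finset.mem_filter]
    refine ⟨hψlist p hp, fun u hu w hw huw => ?_, fun e he hes => ?_⟩
    · have huw' := huw.ne
      by_cases hux : u = x
      · subst hux
        have hwS := (Finset.mem_insert.1 hw).resolve_left huw'.symm
        rw [hψx, hψ p w huw'.symm]
        exact (h1' w hwS huw).symm
      · have huS := (Finset.mem_insert.1 hu).resolve_left hux
        by_cases hwx : w = x
        · subst hwx
          rw [hψx, hψ p u hux]
          exact h1' u huS huw.symm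
        · rw [hψ p u hux, hψ p w hwx]
          exact hprop u huS w ((Finset.mem_insert.1 hw).resolve_left hwx) huw
    · by_cases hxe : x ∈ e
      · by_contra hbad
        exact h2 e (Finset.mem_filter.2 ⟨he, hxe⟩) (Finset.mem_filter.2 ⟨hp, hes, hbad⟩)
      · have heS : e ⊆ S := (Finset.subset_insert_iff_of_notMem hxe).1 hes
        exact (hedge e he heS).congr fun u hu => (hψ p u (by rintro rfl; exact hxe hu)).symm
  have hX : X.card = r * C.card := by
    rw [Finset.card_product, hL, mul_comm]
  have hX₀ : X₀.card ≤ (goodColorings G E L (insert x S)).card :=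
    Finset.card_le_card_of_injOn ψ (fun p hp => (Finset.mem_filter.1 hp).2)
      fun p hp q hq => hψinj p (Finset.mem_filter.1 hp).1 q (Finset.mem_filter.1 hq).1
  have hX₁ : 4 * X₁.card ≤ r * C.card := by
    have hsub : X₁ ⊆ C.biUnion fun f =>
        ((B.filter fun u => G.Adj x u).image f).image fun c => (f, c) := by
      intro p hp
      obtain ⟨hp, u, hu, hxu, heq⟩ := Finset.mem_filter.1 hp
      simp only [Finset.mem_biUnion, Finset.mem_image, Finset.mem_filter]
      exact ⟨p.1, (Finset.mem_product.1 hp).1, p.2, ⟨u, ⟨hSB hu, hxu⟩, heq⟩, rfl⟩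
    have hcard : X₁.card ≤ C.card * M := by
      refine (Finset.card_le_card hsub).trans (Finset.card_biUnion_le_card_mul _ _ _ fun f _ => ?_)
      exact Finset.card_image_le.trans (Finset.card_image_le.trans
        (hB x (hxB (Finset.mem_insert_self x S))))
    calc 4 * X₁.card ≤ 4 * (C.card * M) := by gcongr
      _ = (4 * M) * C.card := by ring
      _ ≤ r * C.card := Nat.mul_le_mul_right _ (by omega)
  have hX₂ : ∀ e ∈ Ex, 2 ^ (6 * e.card + 1) * (X₂ e).card ≤ r * C.card := by
    intro e he
    obtain ⟨heE, hxe⟩ := Finset.mem_filter.1 he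
    by_cases hes : e ⊆ insert x S
    swap
    · have : X₂ e = ∅ := Finset.filter_false_of_mem fun p _ h => hes h.1
      simp [this]
    rcases Nat.eq_zero_or_pos r with hr0 | hr0
    · have : X.card = 0 := by rw [hX, hr0, zero_mul]
      have h0 : (X₂ e).card = 0 :=
        Nat.le_zero.1 ((Finset.card_filter_le _ _).trans this.le)
      simp [h0]
    let R := e.erase x
    have hRS : R ⊆ S := Finset.subset_insert_iff.1 hes
    have hRc : R.card + 1 = e.card := Finset.card_erase_add_one hxe
    let bad := (listColorings L e).filter fun f => ¬ HasUniqueColor f e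
    -- Restricting an extension to `S \ R` and to `e` loses no information, as `S \ R = S \ e`.
    have hprod : (X₂ e).card ≤ (goodColorings G E L (S \ R)).card * bad.card := by
      rw [← Finset.card_product]
      refine Finset.card_le_card_of_injOn
        (fun p => (fun v => if v ∈ S \ R then ψ p v else 0, fun v => if v ∈ e then ψ p v else 0))
        (fun p hp => ?_) fun p hp q hq hpq => ?_
      · obtain ⟨hp, -, hbad⟩ := Finset.mem_filter.1 hp
        refine Finset.mem_product.2 ⟨?_, Finset.mem_filter.2 ⟨?_, fun h => hbad ?_⟩⟩
        · refine indicator_mem_goodColorings Finset.sdiff_subset (Finset.mem_product.1 hp).1 ?_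
          intro v hv
          exact hψ p v (by rintro rfl; exact hxS (Finset.mem_sdiff.1 hv).1)
        · have := mem_listColorings.1 (hψlist p hp)
          exact mem_listColorings.2
            ⟨fun v hv => by simpa [hv] using this.1 v (hes hv), fun v hv => by simp [hv]⟩
        · exact h.congr fun u hu => by simp [hu]
      · have hpX := (Finset.mem_filter.1 hp).1
        have hqX := (Finset.mem_filter.1 hq).1
        refine hψinj p hpX q hqX (funext fun v => ?_)
        have h1 := congrFun (congrArg Prod.fst hpq) v
        have h2 := congrFun (congrArg Prod.snd hpq) v
        by_cases hve : v ∈ e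
        · simpa [hve] using h2
        · by_cases hvS : v ∈ S
          · have : v ∈ S \ R :=
              Finset.mem_sdiff.2 ⟨hvS, fun h => hve (Finset.mem_of_mem_erase h)⟩
            simpa only [this, if_true] using h1
          · have hvI : v ∉ insert x S := by
              rw [Finset.mem_insert, not_or]
              exact ⟨by rintro rfl; exact hve hxe, hvS⟩
            rw [(mem_listColorings.1 (hψlist p hpX)).2 v hvI,
              (mem_listColorings.1 (hψlist q hqX)).2 v hvI]
    have hbad : 2 ^ (7 * e.card) * bad.card ≤ r ^ e.card :=
      card_filter_not_hasUniqueColor hL e ((Nat.mul_le_mul_left _ (hM e heE)).trans hr)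
    have hgood := hrem R hRS
    have h7 : 2 ^ (7 * e.card) = 2 ^ R.card * 2 ^ (6 * e.card + 1) := by
      rw [← pow_add]; congr 1; omega
    refine Nat.le_of_mul_le_mul_left (c := r ^ R.card * 2 ^ R.card) ?_ (by positivity)
    calc r ^ R.card * 2 ^ R.card * (2 ^ (6 * e.card + 1) * (X₂ e).card)
        = r ^ R.card * (2 ^ (7 * e.card) * (X₂ e).card) := by rw [h7]; ring
      _ ≤ r ^ R.card *
            (2 ^ (7 * e.card) * ((goodColorings G E L (S \ R)).card * bad.card)) := by gcongr
      _ = (r ^ R.card * (goodColorings G E L (S \ R)).card) * (2 ^ (7 * e.card) * bad.card) := by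
          ring
      _ ≤ (2 ^ R.card * C.card) * r ^ e.card := Nat.mul_le_mul hgood hbad
      _ = r ^ R.card * 2 ^ R.card * (r * C.card) := by rw [← hRc]; ring
  have hX₂sum : 4 * (Ex.biUnion X₂).card ≤ r * C.card := by
    have hle : 4 * 2 ^ (2 * t) * (Ex.biUnion X₂).card ≤ 2 ^ (2 * t) * (r * C.card) := by
      calc 4 * 2 ^ (2 * t) * (Ex.biUnion X₂).card
          ≤ 4 * 2 ^ (2 * t) * ∑ e ∈ Ex, (X₂ e).card :=
            Nat.mul_le_mul_left _ Finset.card_biUnion_le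
        _ = ∑ e ∈ Ex, 4 * 2 ^ (2 * t) * (X₂ e).card := Finset.mul_sum _ _ _
        _ ≤ ∑ _e ∈ Ex, r * C.card := by
            refine Finset.sum_le_sum fun e he => le_trans ?_ (hX₂ e he)
            obtain ⟨heE, hxe⟩ := Finset.mem_filter.1 he
            have h1 := ht e heE
            have h2 : 0 < e.card := Finset.card_pos.2 ⟨x, hxe⟩
            refine Nat.mul_le_mul_right _ ?_
            calc 4 * 2 ^ (2 * t) = 2 ^ (2 + 2 * t) := by rw [pow_add]; norm_num
              _ ≤ 2 ^ (6 * e.card + 1) := Nat.pow_le_pow_right (by norm_num) (by omega)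
        _ = Ex.card * (r * C.card) := by rw [Finset.sum_const, smul_eq_mul]
        _ ≤ 2 ^ (2 * t) * (r * C.card) :=
            Nat.mul_le_mul_right _ (hE x (hxB (Finset.mem_insert_self x S)))
    refine Nat.le_of_mul_le_mul_left (c := 2 ^ (2 * t)) ?_ (by positivity)
    linarith
  have htot := (Finset.card_le_card hcover).trans
    ((Finset.card_union_le _ _).trans (Nat.add_le_add_left (Finset.card_union_le _ _) _))
  rw [hX] at htot
  omega

lemma goodColorings_nonempty {G : SimpleGraph V} {E : Finset (Finset V)} {L : V → Finset ℕ}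
    {r t M : ℕ} (hL : ∀ v, (L v).card = r) (hr0 : 0 < r) (hr : 2 ^ 16 * M ≤ r) (ht0 : 0 < t)
    (ht : ∀ e ∈ E, t ≤ e.card) (hM : ∀ e ∈ E, e.card ≤ M) {B : Finset V}
    (hB : ∀ x ∈ B, (B.filter fun u => G.Adj x u).card ≤ M)
    (hE : ∀ x ∈ B, (E.filter fun e => x ∈ e).card ≤ 2 ^ (2 * t)) :
    (goodColorings G E L B).Nonempty := by
  suffices h : ∀ S : Finset V, S ⊆ B → 0 < (goodColorings G E L S).card from
    Finset.card_pos.1 (h B subset_rfl)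
  intro S
  induction S using Finset.induction_on with
  | empty =>
    intro _
    rw [goodColorings_empty G L fun e he => Finset.card_pos.1 (ht0.trans_le (ht e he))]
    exact one_pos
  | insert x S hx ih =>
    intro hS
    have h1 := ih ((Finset.subset_insert x S).trans hS)
    have h2 := mul_card_goodColorings_le hL hr ht hM hB hE S x hx hS
    have h3 := Nat.mul_pos hr0 h1
    omega

end Counting

/-! ### The coloured vertices -/

section Skeleton

open scoped Classical

variable {V : Type*}

/-- Independent sets in a neighbourhood have fewer than `k` elements. -/
lemma IsStarFree.card_lt {G : SimpleGraph V} {k : ℕ} (hG : G.IsStarFree k) {v : V} {I : Finset V}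
    (hv : ∀ u ∈ I, G.Adj v u) (hI : ∀ u ∈ I, ∀ w ∈ I, ¬ G.Adj u w) : I.card < k := by
  by_contra hlt
  obtain ⟨J, hJI, hJ⟩ := Finset.exists_subset_card_eq (not_lt.1 hlt)
  let e : Fin k ≃ J := (Finset.equivFinOfCardEq hJ).symm
  have he : ∀ i, (e i : V) ∈ I := fun i => hJI (e i).2
  refine hG ⟨⟨⟨Sum.elim (fun _ => v) fun i => (e i : V), ?_⟩, ?_⟩⟩
  · rintro (i | i) (j | j) hij
    · exact congrArg Sum.inl (Subsingleton.elim i j)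
    · exact absurd hij (hv _ (he j)).ne
    · exact absurd hij (hv _ (he i)).ne'
    · exact congrArg Sum.inr (e.injective (Subtype.ext hij))
  · rintro (i | i) (j | j)
    · exact iff_of_false (G.irrefl (v := v)) (by simp)
    · exact iff_of_true (hv _ (he j)) (by simp)
    · exact iff_of_true (hv _ (he i)).symm (by simp)
    · exact iff_of_false (hI _ (he i) _ (he j)) (by simp)

variable [Fintype V]

/-- The skeleton `B` is a maximal set inducing a `t`-colourable subgraph: outside vertices have
neighbours in each of the `t` colour classes, as otherwise they could be added. In a
`K_{1,k}`-free graph a vertex has fewer than `k` neighbours in each class. -/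
lemma IsStarFree.exists_skeleton {G : SimpleGraph V} {k : ℕ} (hG : G.IsStarFree k) (t : ℕ) :
    ∃ B : Finset V, (∀ v ∉ B, t ≤ (B.filter fun u => G.Adj v u).card) ∧
      ∀ v, (B.filter fun u => G.Adj v u).card ≤ t * k := by
  let P : Finset (V → Option (Fin t)) :=
    Finset.univ.filter fun c => ∀ u w, G.Adj u w → ∀ i, c u = some i → c w ≠ some i
  obtain ⟨c, hcP, hmax⟩ := P.exists_max_image
    (fun c => (Finset.univ.filter fun v => c v ≠ none).card) ⟨fun _ => none, by simp [P]⟩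
  have hc : ∀ u w, G.Adj u w → ∀ i, c u = some i → c w ≠ some i := (Finset.mem_filter.1 hcP).2
  let B : Finset V := Finset.univ.filter fun v => c v ≠ none
  refine ⟨B, fun v hv => ?_, fun v => ?_⟩
  · have hvn : c v = none := by simpa [B] using hv
    have hex : ∀ i, ∃ u, G.Adj v u ∧ c u = some i := by
      intro i
      by_contra! hno
      have hmem : Function.update c v (some i) ∈ P := by
        refine Finset.mem_filter.2 ⟨Finset.mem_univ _, fun u w huw j hu hw => ?_⟩
        have hne := huw.ne
        by_cases huv : u = v
        · subst huv
          rw [Function.update_self] at hu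
          rw [Function.update_of_ne hne.symm] at hw
          exact hno w huw (hw.trans hu.symm)
        · rw [Function.update_of_ne huv] at hu
          by_cases hwv : w = v
          · subst hwv
            rw [Function.update_self] at hw
            exact hno u huw.symm (hu.trans hw.symm)
          · rw [Function.update_of_ne hwv] at hw
            exact hc u w huw j hu hw
      refine (hmax _ hmem).not_gt (Finset.card_lt_card ?_)
      refine Finset.ssubset_iff_of_subset (fun u hu => ?_) |>.2 ⟨v, by simp, hv⟩
      have huv : u ≠ v := by rintro rfl; exact hv hu
      simpa [Function.update_of_ne huv] using hu
    choose g hg hcg using hex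
    calc t = (Finset.univ : Finset (Fin t)).card := by simp
      _ ≤ _ := Finset.card_le_card_of_injOn g (fun i _ => by simp [B, hg i, hcg i])
          fun i _ j _ hij => Option.some.inj (by rw [← hcg i, ← hcg j, hij])
  · have hsub : (B.filter fun u => G.Adj v u) ⊆
        (Finset.univ : Finset (Fin t)).biUnion fun i =>
          Finset.univ.filter fun u => G.Adj v u ∧ c u = some i := by
      intro u hu
      simp only [B, Finset.mem_filter, Finset.mem_univ, true_and] at hu
      obtain ⟨i, hi⟩ := Option.ne_none_iff_exists'.1 hu.1
      simpa using ⟨hu.2, i, hi⟩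
    refine (Finset.card_le_card hsub).trans
      ((Finset.card_biUnion_le_card_mul _ _ k fun i _ => ?_).trans (by simp))
    refine (hG.card_lt (v := v) (fun u hu => ?_) fun u hu w hw huw => ?_).le
    · exact (Finset.mem_filter.1 hu).2.1
    · exact hc u w huw i (Finset.mem_filter.1 hu).2.2 (Finset.mem_filter.1 hw).2.2

/-- Conflict-free choosability from lists of linear size in `t * k`, where `4 ^ t` bounds all
degrees. Vertices of the skeleton see their own colour exactly once since the colouring is proper
there; the others find a unique colour among their neighbours in the skeleton. -/
lemma IsStarFree.isCFCNChoosable {G : SimpleGraph V} {k : ℕ} (hG : G.IsStarFree k) {t r : ℕ}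
    (ht : 0 < t) (hdeg : ∀ v, (Finset.univ.filter fun u => G.Adj v u).card ≤ 2 ^ (2 * t))
    (hr0 : 0 < r) (hr : 2 ^ 16 * (t * k) ≤ r) : G.IsCFCNChoosable r := by
  intro L hL
  obtain ⟨B, hBt, hBk⟩ := hG.exists_skeleton t
  let N : V → Finset V := fun v => B.filter fun u => G.Adj v u
  let E : Finset (Finset V) := (Finset.univ.filter fun v => v ∉ B).image N
  have hEmem : ∀ e ∈ E, ∃ v ∉ B, N v = e := fun e he => by simpa [E] using he
  have hEdeg : ∀ x ∈ B, (E.filter fun e => x ∈ e).card ≤ 2 ^ (2 * t) := by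
    intro x _
    have hsub : (E.filter fun e => x ∈ e) ⊆ (Finset.univ.filter fun u => G.Adj x u).image N := by
      intro e he
      obtain ⟨he, hxe⟩ := Finset.mem_filter.1 he
      obtain ⟨v, -, rfl⟩ := hEmem e he
      exact Finset.mem_image_of_mem N
        (Finset.mem_filter.2 ⟨Finset.mem_univ v, (Finset.mem_filter.1 hxe).2.symm⟩)
    exact (Finset.card_le_card hsub).trans (Finset.card_image_le.trans (hdeg x))
  obtain ⟨f, hf⟩ := goodColorings_nonempty (G := G) (E := E) (B := B) hL hr0 hr ht
    (fun e he => by obtain ⟨v, hv, rfl⟩ := hEmem e he; exact hBt v hv)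
    (fun e he => by obtain ⟨v, -, rfl⟩ := hEmem e he; exact hBk v) (fun x _ => hBk x) hEdeg
  rw [goodColorings, Finset.mem_filter, mem_listColorings] at hf
  obtain ⟨⟨hfL, -⟩, hprop, hedge⟩ := hf
  have hsome : ∀ u c, (if u ∈ B then some (f u) else none) = some c ↔ u ∈ B ∧ f u = c := by
    intro u c
    by_cases hu : u ∈ B <;> simp [hu]
  refine ⟨fun v => if v ∈ B then some (f v) else none, fun v c hvc => ?_, fun v => ?_⟩
  · obtain ⟨hv, rfl⟩ := (hsome v c).1 hvc
    exact hfL v hv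
  · by_cases hv : v ∈ B
    · refine ⟨f v, v, ⟨Set.mem_insert _ _, (hsome _ _).2 ⟨hv, rfl⟩⟩, ?_⟩
      rintro w ⟨hw, hwc⟩
      obtain ⟨hwB, hwv⟩ := (hsome _ _).1 hwc
      rcases hw with hw | hw
      · exact hw
      · exact absurd hwv.symm (hprop v hv w hwB hw)
    · obtain ⟨u, hu, huniq⟩ := hedge (N v)
        (Finset.mem_image_of_mem N (by simpa using hv)) (Finset.filter_subset _ _)
      obtain ⟨huB, hvu⟩ := Finset.mem_filter.1 hu
      refine ⟨f u, u, ⟨Set.mem_insert_of_mem _ hvu, (hsome _ _).2 ⟨huB, rfl⟩⟩, ?_⟩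
      rintro w ⟨hw, hwc⟩
      obtain ⟨hwB, hwu⟩ := (hsome _ _).1 hwc
      rcases hw with hw | hw
      · exact absurd (hw ▸ hwB) hv
      · exact huniq w (Finset.mem_filter.2 ⟨hwB, hw⟩) hwu

end Skeleton

/-! ### The bound in terms of the maximum degree -/

/-- The bound from `t = ⌈log Δ⌉` colour classes, for which `Δ ≤ exp t ≤ 4 ^ t` and `t ≤ 4 * log
Δ`. -/
lemma IsStarFree.isCFCNChoosable_of_log_le {V : Type*} [Fintype V] {G : SimpleGraph V}
    [DecidableRel G.Adj] {k : ℕ} (hG : G.IsStarFree k) (hΔ : 2 ≤ G.maxDegree) {r : ℕ}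
    (hr : 2 ^ 18 * k * Real.log G.maxDegree ≤ (r : ℝ)) : 0 < r ∧ G.IsCFCNChoosable r := by
  have hΔ' : (2 : ℝ) ≤ G.maxDegree := by exact_mod_cast hΔ
  have hlog : 0.69 < Real.log G.maxDegree :=
    lt_of_lt_of_le (by linarith [Real.log_two_gt_d9]) (Real.log_le_log two_pos hΔ')
  have hk : 0 < k := by
    have hV : Nonempty V := by
      by_contra h
      rw [not_nonempty_iff] at h
      simp at hΔ
    exact (Nat.zero_le _).trans_lt (hG.card_lt (v := hV.some) (I := ∅) (by simp) (by simp))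
  have hk' : (1 : ℝ) ≤ k := by exact_mod_cast hk
  have hr0 : 0 < r := by
    have : (0 : ℝ) < 2 ^ 18 * k * Real.log G.maxDegree := by positivity
    exact_mod_cast this.trans_le hr
  set t := ⌈Real.log G.maxDegree⌉₊ with ht
  have ht0 : 0 < t := Nat.ceil_pos.2 (by linarith)
  have ht4 : (t : ℝ) ≤ 4 * Real.log G.maxDegree := by
    have := Nat.ceil_lt_add_one (a := Real.log G.maxDegree) (by linarith)
    linarith
  have hΔt : G.maxDegree ≤ 2 ^ (2 * t) := by
    have h1 : (G.maxDegree : ℝ) ≤ Real.exp 1 ^ t := by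
      rw [← Real.exp_nat_mul, mul_one, ← Real.log_le_iff_le_exp (by linarith)]
      exact Nat.le_ceil _
    have h2 : Real.exp 1 ^ t ≤ (4 : ℝ) ^ t :=
      pow_le_pow_left₀ (Real.exp_pos 1).le (by linarith [Real.exp_one_lt_d9]) t
    have h3 : (G.maxDegree : ℝ) ≤ ((4 ^ t : ℕ) : ℝ) := by push_cast; exact h1.trans h2
    rw [pow_mul]
    exact_mod_cast h3
  refine ⟨hr0, hG.isCFCNChoosable ht0 (fun v => ?_) hr0 ?_⟩
  · refine le_trans (le_of_eq ?_) ((G.degree_le_maxDegree v).trans hΔt)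
    rw [← G.card_neighborFinset_eq_degree]
    congr 1
    ext u
    simp
  · have h : (2 ^ 16 * (t * k) : ℝ) ≤ r := by
      refine le_trans ?_ hr
      have := mul_le_mul_of_nonneg_right ht4 (by positivity : (0 : ℝ) ≤ 2 ^ 16 * k)
      linarith
    exact_mod_cast h

end SimpleGraph

theorem theorem2p2 :
    ∃ C : ℝ, 0 < C ∧
      ∀ (V : Type u) [Fintype V] (G : SimpleGraph V) [DecidableRel G.Adj] (k : ℕ),
        G.IsStarFree k → 2 ≤ G.maxDegree →
          (G.cfcnChoiceNumber : ℝ) ≤ C * (k * Real.log G.maxDegree) ∧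
          ((k : ℝ) ≤ Real.log G.maxDegree / 8 →
            ∀ r : ℕ, 2 ^ 18 * k * Real.log G.maxDegree ≤ (r : ℝ) → G.IsCFCNChoosable r) := by
  refine ⟨2 ^ 19, by norm_num, fun V _ G _ k hG hΔ => ⟨?_, fun _ r hr =>
    (hG.isCFCNChoosable_of_log_le hΔ hr).2⟩⟩
  set x : ℝ := 2 ^ 18 * k * Real.log G.maxDegree with hx
  have hx0 : 0 ≤ x := by positivity
  have hle : G.cfcnChoiceNumber ≤ ⌈x⌉₊ :=
    G.isLeast_cfcnChoiceNumber.2 (hG.isCFCNChoosable_of_log_le hΔ (Nat.le_ceil x))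
  have hk : 0 < k := by
    by_contra h
    obtain rfl : k = 0 := by omega
    have := (hG.isCFCNChoosable_of_log_le hΔ (r := 0) (by simp)).1
    omega
  have hx1 : 1 ≤ x := by
    have hΔ' : (2 : ℝ) ≤ G.maxDegree := by exact_mod_cast hΔ
    have hk' : (1 : ℝ) ≤ k := by exact_mod_cast hk
    have hlog : 0.69 < Real.log G.maxDegree :=
      lt_of_lt_of_le (by linarith [Real.log_two_gt_d9]) (Real.log_le_log two_pos hΔ')
    nlinarith
  -- Rounding up costs at most a factor `2`, as `x ≥ 1`.
  have h1 : (G.cfcnChoiceNumber : ℝ) ≤ ⌈x⌉₊ := by exact_mod_cast hle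
  have h2 := Nat.ceil_lt_add_one hx0
  have h3 : 2 ^ 19 * (k * Real.log G.maxDegree) = 2 * x := by rw [hx]; ring
  linarith
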